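/- Let $N,m\ge 1$ be integers, let $\Omega\subset\mathbb R^N$ be a bounded domain, let $0<q<1$, and let $a:\Omega\to[0,\infty)$ be bounded and measurable. Write $\|\cdot\|$ for the norm of $L^2(\Omega)$ and let $W_0^{m,2}(\Omega)$ be the closure in the $W^{m,2}(\Omega)$-norm of the space $C_0^m(\Omega)$ of $C^m$ functions with compact support in $\Omega$; put $|D^m v|^2=\sum_{|\alpha|=m}|D^\alpha v|^2$. For $|\alpha|=m$ let $a_\alpha(x,\xi)$, where $x\in\Omega$ and $\xi=(\xi_\gamma)_{|\gamma|\le m}$, be real Carathéodory functions (measurable in $x$, continuous in $\xi$) such that $|a_\alpha(x,\xi)|\le c\sum_{|\gamma|=m}|\xi_\gamma|$ with a constant $c$, and such that for some constant $C>0$ $$\int_\Omega\sum_{|\alpha|=m}a_\alpha(x,v,\dots,D^mv)\,D^\alpha v\,dx\ \ge\ C\int_\Omega|D^mv|^2\,dx\qquad\text{for all } v\in W_0^{m,2}(\Omega).$$ Given $u_0\in L^2(\Omega)$, consider the Cauchy–Dirichlet problem $$u_t+(-1)^m\sum_{|\alpha|=m}D^\alpha a_\alpha(x,u,\dots,D^mu)+a(x)|u|^{q-1}u=0\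 \text{ in }\Omega\times(0,\infty),\qquad D^\alpha u=0\ \text{ on }\partial\Omega\times(0,\infty)\ (|\alpha|\le m-1),\qquad u(\cdot,0)=u_0 .$$ A weak solution is a function $u\in C([0,\infty),L^2(\Omega))\cap L^2_{loc}([0,\infty),W_0^{m,2}(\Omega))$ with $u(\cdot,0)=u_0$ and $u_t\in L^2_{loc}([0,\infty),(W_0^{m,2}(\Omega))^*)$ such that for all $\zeta\in L^2_{loc}([0,\infty),W_0^{m,2}(\Omega))$ and all $T>0$ $$\int_0^T\Big[\langle u_t,\zeta\rangle+\int_\Omega\Big(\sum_{|\alpha|=m}a_\alpha(x,u,\dots,D^mu)D^\alpha\zeta+a(x)|u|^{q-1}u\,\zeta\Big)dx\Big]dt=0 .$$ For $h>0$ set $$\lambda_1(h)=\inf\Big\{\int_\Omega\big(|D^mv|^2+a(x)|v|^{1+q}\big)\,dx:\ v\in W_0^{m,2}(\Omega),\ \|v\|^2=h\Big\}$$ (with $1/0=+\infty$ below). If $\displaystyle\int_0^1\frac{dh}{\lambda_1(h)}<\infty$, then every weak solution $u$ vanishes in finite time: there is a least $T\ge 0$ such that $u(\cdot,t)=0$ a.e.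 in $\Omega$ for all $t\ge T$. Moreover $\int_0^{\|u_0\|^2}\frac{dh}{\lambda_1(h)}$ is finite and $$T\ \le\ \frac{1}{2\min\{1,C\}}\int_0^{\|u_0\|^2}\frac{dh}{\lambda_1(h)} ;$$ in particular, if $C\ge 1$, then $T\le\frac12\int_0^{\|u_0\|^2}\frac{dh}{\lambda_1(h)}$. -/

import Mathlib

open MeasureTheory Set
open scoped ENNReal ContDiff

noncomputable section

namespace Extinction

/-- Multi-indices `α = (α₁, …, α_N)` of length `|α| = α₁ + ⋯ + α_N ≤ m`
(every entry is then automatically at most `m`). -/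
abbrev MultiIndex (N m : ℕ) : Type :=
  {α : Fin N → Fin (m + 1) // ∑ i, (α i : ℕ) ≤ m}

/-- Multi-indices of length exactly `m`. -/
abbrev TopIndex (N m : ℕ) : Type :=
  {α : MultiIndex N m // ∑ i, (α.1 i : ℕ) = m}

/-- The multi-index `0`. -/
def zeroIndex (N m : ℕ) : MultiIndex N m := ⟨fun _ => 0, by simp⟩

/-- The classical partial derivative `∂f/∂xᵢ`. -/
def partialDeriv {N : ℕ} (i : Fin N) (f : EuclideanSpace ℝ (Fin N) → ℝ) :
    EuclideanSpace ℝ (Fin N) → ℝ :=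
  fun x => fderiv ℝ f x (EuclideanSpace.single i 1)

/-- The classical mixed derivative `D^α f = ∂₁^{α₁} ⋯ ∂_N^{α_N} f`. -/
def mixedDeriv {N : ℕ} (α : Fin N → ℕ) (f : EuclideanSpace ℝ (Fin N) → ℝ) :
    EuclideanSpace ℝ (Fin N) → ℝ :=
  (List.finRange N).foldr (fun i g => (partialDeriv i)^[α i] g) f

theorem partialDeriv_contDiff {N : ℕ} (i : Fin N) {k : ℕ} {f : EuclideanSpace ℝ (Fin N) → ℝ}
    (hf : ContDiff ℝ ((k + 1 : ℕ) : WithTop ℕ∞) f) :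
    ContDiff ℝ (k : WithTop ℕ∞) (partialDeriv i f) := by
  have h : ContDiff ℝ (k : WithTop ℕ∞) (fderiv ℝ f) :=
    hf.fderiv_right (by push_cast; exact le_rfl)
  exact h.clm_apply contDiff_const

theorem partialDeriv_linear {N : ℕ} (i : Fin N) {k : ℕ} {f g : EuclideanSpace ℝ (Fin N) → ℝ}
    (hf : ContDiff ℝ ((k + 1 : ℕ) : WithTop ℕ∞) f)
    (hg : ContDiff ℝ ((k + 1 : ℕ) : WithTop ℕ∞) g) (c : ℝ) :
    partialDeriv i (f + c • g) = partialDeriv i f + c • partialDeriv i g := by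
  funext x
  have hf' : DifferentiableAt ℝ f x := (hf.differentiable (by simp)) x
  have hg' : DifferentiableAt ℝ g x := (hg.differentiable (by simp)) x
  simp only [partialDeriv, Pi.add_apply, Pi.smul_apply]
  rw [fderiv_add hf' (hg'.const_smul c), fderiv_const_smul hg' c]
  simp

theorem partialDeriv_iterate_linear {N : ℕ} (i : Fin N) (j : ℕ) : ∀ {k : ℕ}
    {f g : EuclideanSpace ℝ (Fin N) → ℝ},
    ContDiff ℝ ((k + j : ℕ) : WithTop ℕ∞) f → ContDiff ℝ ((k + j : ℕ) : WithTop ℕ∞) g →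
    ∀ c : ℝ, ContDiff ℝ (k : WithTop ℕ∞) ((partialDeriv i)^[j] f) ∧
      (partialDeriv i)^[j] (f + c • g) =
        (partialDeriv i)^[j] f + c • (partialDeriv i)^[j] g := by
  induction j with
  | zero => intro k f g hf hg c; exact ⟨hf, rfl⟩
  | succ j ih =>
    intro k f g hf hg c
    simp only [Function.iterate_succ, Function.comp_apply]
    rw [partialDeriv_linear i (k := k + j) hf hg c]
    exact ih (partialDeriv_contDiff i (k := k + j) hf) (partialDeriv_contDiff i (k := k + j) hg) c

theorem foldr_linear {N : ℕ} (α : Fin N → ℕ) (l : List (Fin N)) : ∀ {k : ℕ}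
    {f g : EuclideanSpace ℝ (Fin N) → ℝ},
    ContDiff ℝ ((k + (l.map α).sum : ℕ) : WithTop ℕ∞) f →
    ContDiff ℝ ((k + (l.map α).sum : ℕ) : WithTop ℕ∞) g →
    ∀ c : ℝ, ContDiff ℝ (k : WithTop ℕ∞) (l.foldr (fun i g => (partialDeriv i)^[α i] g) f) ∧
      l.foldr (fun i g => (partialDeriv i)^[α i] g) (f + c • g) =
        l.foldr (fun i g => (partialDeriv i)^[α i] g) f +
          c • l.foldr (fun i g => (partialDeriv i)^[α i] g) g := by
  induction l with
  | nil => intro k f g hf hg c; exact ⟨by simpa using hf, rfl⟩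
  | cons i l ih =>
    intro k f g hf hg c
    simp only [List.map_cons, List.sum_cons, ← add_assoc] at hf hg
    simp only [List.foldr_cons]
    obtain ⟨h1, h2⟩ := ih (k := k + α i) hf hg c
    obtain ⟨h3, -⟩ := ih (k := k + α i) hg hf c
    rw [h2]
    exact partialDeriv_iterate_linear i (α i) h1 h3 c

theorem mixedDeriv_linear {N m : ℕ} (α : MultiIndex N m)
    {f g : EuclideanSpace ℝ (Fin N) → ℝ} (hf : ContDiff ℝ (m : WithTop ℕ∞) f)
    (hg : ContDiff ℝ (m : WithTop ℕ∞) g) (c : ℝ) :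
    mixedDeriv (fun i => (α.1 i : ℕ)) (f + c • g) =
      mixedDeriv (fun i => (α.1 i : ℕ)) f + c • mixedDeriv (fun i => (α.1 i : ℕ)) g := by
  have hs : ((List.finRange N).map (fun i => (α.1 i : ℕ))).sum ≤ m := by
    have h := α.2
    rwa [← List.sum_ofFn, List.ofFn_eq_map] at h
  have hle : ((0 + ((List.finRange N).map (fun i => (α.1 i : ℕ))).sum : ℕ) : WithTop ℕ∞) ≤
      (m : WithTop ℕ∞) := by
    rw [zero_add]; exact_mod_cast hs
  exact (foldr_linear (fun i => (α.1 i : ℕ)) (List.finRange N) (k := 0)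
    (hf.of_le hle) (hg.of_le hle) c).2

theorem mixedDeriv_zero {N m : ℕ} (α : MultiIndex N m) :
    mixedDeriv (fun i => (α.1 i : ℕ)) (0 : EuclideanSpace ℝ (Fin N) → ℝ) = 0 := by
  have h := mixedDeriv_linear (N := N) α (f := 0) (g := 0) contDiff_const contDiff_const 1
  simpa using h

/-- The real space `L²(Ω)`. -/
abbrev L2 {N : ℕ} (Ω : Set (EuclideanSpace ℝ (Fin N))) : Type :=
  Lp ℝ 2 (volume.restrict Ω)

/-- Families `(v_α)_{|α| ≤ m}` in `L²(Ω)` with the norm `(∑_{|α| ≤ m} ‖v_α‖²)^{1/2}`.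
The space `W^{m,2}(Ω)` sits in it isometrically through `v ↦ (D^α v)_{|α| ≤ m}`. -/
abbrev Jet {N : ℕ} (m : ℕ) (Ω : Set (EuclideanSpace ℝ (Fin N))) : Type :=
  PiLp 2 (fun _ : MultiIndex N m => L2 Ω)

/-- `C₀^m(Ω)`: functions of class `C^m` with compact support contained in `Ω`. -/
def IsTest {N : ℕ} (m : ℕ) (Ω : Set (EuclideanSpace ℝ (Fin N)))
    (φ : EuclideanSpace ℝ (Fin N) → ℝ) : Prop :=
  ContDiff ℝ (m : WithTop ℕ∞) φ ∧ HasCompactSupport φ ∧ tsupport φ ⊆ Ω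

theorem IsTest.add_smul {N m : ℕ} {Ω : Set (EuclideanSpace ℝ (Fin N))}
    {φ ψ : EuclideanSpace ℝ (Fin N) → ℝ} (hφ : IsTest m Ω φ) (hψ : IsTest m Ω ψ) (c : ℝ) :
    IsTest m Ω (φ + c • ψ) := by
  have hc : tsupport (c • ψ) ⊆ tsupport ψ :=
    closure_mono (Function.support_const_smul_subset c ψ)
  refine ⟨hφ.1.add (hψ.1.const_smul c), hφ.2.1.add ?_, ?_⟩
  · exact hψ.2.1.of_isClosed_subset (isClosed_tsupport _) hc
  · exact (tsupport_add φ (c • ψ)).trans (union_subset hφ.2.2 (hc.trans hψ.2.2))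

/-- The image of `C₀^m(Ω)` under `φ ↦ (D^α φ)_{|α| ≤ m}`. -/
def testJets {N : ℕ} (m : ℕ) (Ω : Set (EuclideanSpace ℝ (Fin N))) : Submodule ℝ (Jet m Ω) where
  carrier := {V | ∃ φ, IsTest m Ω φ ∧ ∀ α : MultiIndex N m,
    (V α : EuclideanSpace ℝ (Fin N) → ℝ) =ᵐ[volume.restrict Ω]
      mixedDeriv (fun i => (α.1 i : ℕ)) φ}
  add_mem' := by
    rintro V W ⟨φ, hφ, hV⟩ ⟨ψ, hψ, hW⟩
    refine ⟨φ + (1 : ℝ) • ψ, hφ.add_smul hψ 1, fun α => ?_⟩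
    rw [mixedDeriv_linear α hφ.1 hψ.1 1]
    filter_upwards [Lp.coeFn_add (V α) (W α), hV α, hW α] with x h1 h2 h3
    rw [PiLp.add_apply, h1]
    simp [h2, h3]
  zero_mem' := by
    refine ⟨0, ⟨contDiff_const, HasCompactSupport.zero, by simp [tsupport]⟩, fun α => ?_⟩
    rw [mixedDeriv_zero α]
    exact Lp.coeFn_zero ℝ 2 (volume.restrict Ω)
  smul_mem' := by
    rintro c V ⟨φ, hφ, hV⟩
    have h0 : IsTest m Ω (0 : EuclideanSpace ℝ (Fin N) → ℝ) :=
      ⟨contDiff_const, HasCompactSupport.zero, by simp [tsupport]⟩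
    refine ⟨0 + c • φ, h0.add_smul hφ c, fun α => ?_⟩
    rw [mixedDeriv_linear α h0.1 hφ.1 c, mixedDeriv_zero α]
    filter_upwards [Lp.coeFn_smul c (V α), hV α] with x h1 h2
    rw [PiLp.smul_apply, h1]
    simp [h2]

/-- `W₀^{m,2}(Ω)`: the closure of `C₀^m(Ω)` in the `W^{m,2}(Ω)` norm. An element is stored with
its derivatives, as the family `(D^α v)_{|α| ≤ m}`. -/
def W0 {N : ℕ} (m : ℕ) (Ω : Set (EuclideanSpace ℝ (Fin N))) : Submodule ℝ (Jet m Ω) :=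
  (testJets m Ω).topologicalClosure

/-- The (weak) derivative `D^α v` of `v ∈ W₀^{m,2}(Ω)`, `|α| ≤ m`. -/
def W0.D {N m : ℕ} {Ω : Set (EuclideanSpace ℝ (Fin N))} (v : W0 m Ω) (α : MultiIndex N m) :
    L2 Ω := (v : Jet m Ω) α

/-- The function `v` itself, as an element of `L²(Ω)`. -/
def W0.fn {N m : ℕ} {Ω : Set (EuclideanSpace ℝ (Fin N))} (v : W0 m Ω) : L2 Ω :=
  W0.D v (zeroIndex N m)

/-- The values `(v(x), D v(x), …, D^m v(x)) ∈ ℝ^{M(m)}`. -/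
def W0.jetAt {N m : ℕ} {Ω : Set (EuclideanSpace ℝ (Fin N))} (v : W0 m Ω)
    (x : EuclideanSpace ℝ (Fin N)) : MultiIndex N m → ℝ := fun α => W0.D v α x

/-- `|D^m v(x)|² = ∑_{|α| = m} |D^α v(x)|²`. -/
def W0.topSq {N m : ℕ} {Ω : Set (EuclideanSpace ℝ (Fin N))} (v : W0 m Ω)
    (x : EuclideanSpace ℝ (Fin N)) : ℝ := ∑ α : TopIndex N m, |W0.D v α.1 x| ^ 2

/-- `λ₁(h)`, the infimum of `∫_Ω (|D^m v|² + a |v|^{1+q}) dx` over `v ∈ W₀^{m,2}(Ω)` with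
`‖v‖²_{L²(Ω)} = h`, as an element of `[0, ∞]`. -/
def lambda1 {N : ℕ} (m : ℕ) (Ω : Set (EuclideanSpace ℝ (Fin N)))
    (a : EuclideanSpace ℝ (Fin N) → ℝ) (q h : ℝ) : ℝ≥0∞ :=
  ⨅ (v : W0 m Ω) (_ : ‖W0.fn v‖ ^ 2 = h),
    ∫⁻ x in Ω, ENNReal.ofReal (W0.topSq v x + a x * |W0.fn v x| ^ (1 + q))

/-- The coefficients `a_α(x, ξ)`, `|α| = m`, `ξ ∈ ℝ^{M(m)}`, of the operator
`L(u) = (-1)^m ∑_{|α| = m} D^α a_α(x, u, Du, …, D^m u)`. -/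
abbrev Coeff (N m : ℕ) : Type :=
  TopIndex N m → EuclideanSpace ℝ (Fin N) → (MultiIndex N m → ℝ) → ℝ

/-- Carathéodory functions on `Ω`: measurable in `x`, continuous in `ξ`. -/
def IsCaratheodory {N m : ℕ} (Ω : Set (EuclideanSpace ℝ (Fin N))) (A : Coeff N m) : Prop :=
  ∀ α, (∀ ξ, AEMeasurable (fun x => A α x ξ) (volume.restrict Ω)) ∧
    ∀ x ∈ Ω, Continuous (A α x)

/-- The growth condition `|a_α(x, ξ)| ≤ c ∑_{|γ| = m} |ξ_γ|`. -/
def HasSublinearGrowth {N m : ℕ} (Ω : Set (EuclideanSpace ℝ (Fin N))) (A : Coeff N m) : Prop :=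
  ∃ c : ℝ, ∀ α, ∀ x ∈ Ω, ∀ ξ, |A α x ξ| ≤ c * ∑ γ : TopIndex N m, |ξ γ.1|

/-- `∑_{|α| = m} a_α(x, v, …, D^m v) D^α w` at the point `x`. -/
def fluxDensity {N m : ℕ} {Ω : Set (EuclideanSpace ℝ (Fin N))} (A : Coeff N m) (v w : W0 m Ω)
    (x : EuclideanSpace ℝ (Fin N)) : ℝ :=
  ∑ α : TopIndex N m, A α x (W0.jetAt v x) * W0.D w α.1 x

/-- Coercivity with constant `C`: `(L(v), v) ≥ C ∫_Ω |D^m v|² dx` for all `v ∈ W₀^{m,2}(Ω)`. -/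
def IsCoercive {N m : ℕ} (Ω : Set (EuclideanSpace ℝ (Fin N))) (A : Coeff N m) (C : ℝ) : Prop :=
  ∀ v : W0 m Ω, C * (∫ x in Ω, W0.topSq v x) ≤ ∫ x in Ω, fluxDensity A v v x

/-- Membership in `L²_loc([0, ∞), X)`. -/
def MemL2Loc {X : Type*} [NormedAddCommGroup X] (z : ℝ → X) : Prop :=
  ∀ T : ℝ, 0 < T → MemLp z 2 (volume.restrict (Ioc 0 T))

/-- `G` is the derivative `u_t` of `u` in the sense of distributions on `(0, ∞)` with values in
the dual of `W₀^{m,2}(Ω)`, where `L²(Ω)` is embedded in that dual by the `L²` inner product. -/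
def IsTimeDeriv {N m : ℕ} {Ω : Set (EuclideanSpace ℝ (Fin N))} (u : ℝ → L2 Ω)
    (G : ℝ → StrongDual ℝ (W0 m Ω)) : Prop :=
  ∀ (w : W0 m Ω) (φ : ℝ → ℝ), ContDiff ℝ ∞ φ → HasCompactSupport φ → tsupport φ ⊆ Ioi 0 →
    (∫ t in Ioi (0 : ℝ), deriv φ t * inner ℝ (u t) (W0.fn w)) =
      -∫ t in Ioi (0 : ℝ), φ t * G t w

/-- Weak solutions on `[0, ∞)` of `u_t + L(u) + a(x)|u|^{q-1}u = 0` with homogeneous Dirichlet data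
and `u(0) = u₀`: `u ∈ C([0, ∞), L²(Ω)) ∩ L²_loc([0, ∞), W₀^{m,2}(Ω))` (`U` is `u`, seen as a
function of time with values in `W₀^{m,2}(Ω)`), `u_t ∈ L²_loc([0, ∞), W₀^{m,2}(Ω)*)`, and the
integral identity holds for all `ζ ∈ L²_loc([0, ∞), W₀^{m,2}(Ω))` and all `T > 0`. -/
def IsWeakSolution {N m : ℕ} {Ω : Set (EuclideanSpace ℝ (Fin N))} (A : Coeff N m)
    (a : EuclideanSpace ℝ (Fin N) → ℝ) (q : ℝ) (u₀ : L2 Ω) (u : ℝ → L2 Ω) : Prop :=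
  ContinuousOn u (Ici 0) ∧ u 0 = u₀ ∧
  ∃ (U : ℝ → W0 m Ω) (G : ℝ → StrongDual ℝ (W0 m Ω)),
    MemL2Loc U ∧ (∀ᵐ t ∂(volume.restrict (Ioi (0 : ℝ))), W0.fn (U t) = u t) ∧
    MemL2Loc G ∧ IsTimeDeriv u G ∧
    ∀ z : ℝ → W0 m Ω, MemL2Loc z → ∀ T : ℝ, 0 < T →
      IntegrableOn (fun t => G t (z t) + ∫ x in Ω, (fluxDensity A (U t) (z t) x +
        a x * (|W0.fn (U t) x| ^ (q - 1) * W0.fn (U t) x) * W0.fn (z t) x)) (Ioc 0 T) ∧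
      ∫ t in Ioc 0 T, (G t (z t) + ∫ x in Ω, (fluxDensity A (U t) (z t) x +
        a x * (|W0.fn (U t) x| ^ (q - 1) * W0.fn (U t) x) * W0.fn (z t) x)) = 0

/-- `T` is the extinction time of `u`: the least `T ≥ 0` such that `u(·, t) = 0` a.e. in `Ω` for
all `t ≥ T`. -/
def IsExtinctionTime {N : ℕ} {Ω : Set (EuclideanSpace ℝ (Fin N))} (u : ℝ → L2 Ω) (T : ℝ) : Prop :=
  IsLeast {s : ℝ | 0 ≤ s ∧ ∀ t, s ≤ t → u t = 0} T

end Extinction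

end

/-! Testing the equation with `u` itself gives `y' ≤ -2 min{1, C} λ₁(y)` for `y = ‖u‖²`. Dividing by
`λ₁(y)` and integrating, `y` can stay positive at most up to the time `(2 min{1, C})⁻¹ ∫_0^{y(0)} dh
/ λ₁(h)`. Continuity of `u` gives a first zero, and since `y` is nonincreasing `u` stays zero
afterwards.

Two points need care. Since `u_t` lives only in the dual space, `energy_inequality` takes the place
of the chain rule for `‖u‖²`; one direction suffices, and it follows from difference quotients and
continuity of translations in `L²`. The decay of `y` is then used in integrated form only, and
`mul_time_le_lintegral_inv` sums it over fine partitions of the time interval.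

What the summation needs from `λ₁` comes from the scaling `v ↦ σ v`: the energy has terms of degrees
`2` and `1 + q < 2`, so `λ₁(h)` is nondecreasing (`lambda1_mono`) and `λ₁(h) / h` is nonincreasing
(`lambda1_le_div_mul`). Convergence of the integral near `0` makes `λ₁` positive, and a solution
that is not yet extinct makes it finite. -/

namespace Extinction

open Filter Topology

/-! ### Duality pairings of translated square integrable functions. -/

section Pairing

variable {V : Type*} [NormedAddCommGroup V] [NormedSpace ℝ V]

theorem integrable_pairing {α : Type*} [MeasurableSpace α] {μ : Measure α}
    {g : α → StrongDual ℝ V} {w : α → V} (hg : MemLp g 2 μ) (hw : MemLp w 2 μ) :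
    Integrable (fun t => g t (w t)) μ :=
  memLp_one_iff_integrable.1
    ((ContinuousLinearMap.id ℝ (StrongDual ℝ V)).memLp_of_bilin 1 hg hw)

theorem continuous_translate_toLp {E : Type*} [NormedAddCommGroup E] {f : ℝ → E}
    (hf : MemLp f 2 volume) :
    Continuous fun r : ℝ =>
      (hf.comp_measurePreserving (measurePreserving_add_right volume r)).toLp (fun t => f (t + r)) := by
  have : Fact ((2 : ℝ≥0∞) ≠ ⊤) := ⟨by simp⟩
  have h : Continuous fun r : ℝ => DomAddAct.mk r +ᵥ hf.toLp f :=
    (DomAddAct.mkHomeomorph (M := ℝ)).continuous.vadd continuous_const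
  refine h.congr fun r => ?_
  rw [DomAddAct.mk_vadd_toLp]
  congr 1
  funext t
  simp [add_comm]

/-- Continuity of `(r, h) ↦ ∫_S ⟨g(t + r), w(t + h)⟩ dt` for `g` and `w` square integrable. -/
theorem continuous_translate_pairing {g : ℝ → StrongDual ℝ V} {w : ℝ → V}
    (hg : MemLp g 2 volume) (hw : MemLp w 2 volume) (S : Set ℝ) :
    Continuous fun p : ℝ × ℝ => ∫ t in S, g (t + p.1) (w (t + p.2)) := by
  have hG := continuous_translate_toLp hg
  have hW := continuous_translate_toLp hw
  have hB := ((((ContinuousLinearMap.id ℝ (StrongDual ℝ V)).holderL volume 2 2 1).continuous.comp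
    (hG.comp continuous_fst)).clm_apply (hW.comp continuous_snd))
  refine ((continuous_setIntegral S).comp hB).congr fun p => ?_
  refine integral_congr_ae (ae_restrict_of_ae ?_)
  filter_upwards [(ContinuousLinearMap.id ℝ (StrongDual ℝ V)).coeFn_holder (r := 1)
      ((hg.comp_measurePreserving (measurePreserving_add_right volume p.1)).toLp
        (fun t => g (t + p.1)))
      ((hw.comp_measurePreserving (measurePreserving_add_right volume p.2)).toLp
        (fun t => w (t + p.2))),
    (hg.comp_measurePreserving (measurePreserving_add_right volume p.1)).coeFn_toLp,
    (hw.comp_measurePreserving (measurePreserving_add_right volume p.2)).coeFn_toLp]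
    with t h1 h2 h3
  refine h1.trans ?_
  exact congr_arg₂ (fun (l : StrongDual ℝ V) x => l x) h2 h3

theorem integral_translate_pairing_comm {g : ℝ → StrongDual ℝ V} {w : ℝ → V}
    (hg : MemLp g 2 volume) (hw : MemLp w 2 volume) (S : Set ℝ) (h : ℝ) :
    ∫ t in S, ∫ r in Ioc 0 h, g (t + r) (w (t + h)) =
      ∫ r in Ioc 0 h, ∫ t in S, g (t + r) (w (t + h)) := by
  refine integral_integral_swap ?_
  refine Integrable.mono_measure ?_ (Measure.prod_mono Measure.restrict_le_self le_rfl)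
  refine integrable_pairing ?_ ?_
  -- A measure-preserving shear of the product turns `g(t)` into `g(t + r)`; for this `t` has to
  -- range over the whole line.
  · exact (hg.comp_fst (volume.restrict (Ioc 0 h))).comp_measurePreserving
      (measurePreserving_add_prod (volume : Measure ℝ) (volume.restrict (Ioc 0 h)))
  · exact (hw.comp_measurePreserving (measurePreserving_add_right volume h)).comp_fst
      (volume.restrict (Ioc 0 h))

end Pairing

/-! ### From a distributional derivative to the fundamental theorem of calculus. -/

section WeakDerivative

open Real (smoothTransition)

theorem deriv_smoothTransition_eq_zero {x : ℝ} (hx : x ∉ Ioo (0 : ℝ) 1) :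
    deriv smoothTransition x = 0 := by
  rcases le_or_gt x 0 with h | h
  · refine IsLocalMin.deriv_eq_zero (Eventually.of_forall fun y => ?_)
    rw [smoothTransition.zero_of_nonpos h]
    exact smoothTransition.nonneg y
  · have h1 : 1 ≤ x := by
      by_contra! h1
      exact hx ⟨h, h1⟩
    refine IsLocalMax.deriv_eq_zero (Eventually.of_forall fun y => ?_)
    rw [smoothTransition.one_of_one_le h1]
    exact smoothTransition.le_one y

theorem continuous_deriv_smoothTransition : Continuous (deriv smoothTransition) :=
  (smoothTransition.contDiff (n := 1)).continuous_deriv le_rfl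

theorem integral_deriv_smoothTransition : ∫ x in (0 : ℝ)..1, deriv smoothTransition x = 1 := by
  rw [intervalIntegral.integral_deriv_eq_sub]
  · simp
  · exact fun x _ => (smoothTransition.contDiff (n := 1)).differentiable (by simp) x
  · exact continuous_deriv_smoothTransition.intervalIntegrable _ _

theorem hasDerivAt_smoothTransition_scaled (c ε r : ℝ) :
    HasDerivAt (fun r => smoothTransition ((r - c) / ε))
      (ε⁻¹ * deriv smoothTransition ((r - c) / ε)) r := by
  have h1 : HasDerivAt smoothTransition (deriv smoothTransition ((r - c) / ε)) ((r - c) / ε) :=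
    ((smoothTransition.contDiff (n := 1)).differentiable (by simp) _).hasDerivAt
  have h2 : HasDerivAt (fun r : ℝ => (r - c) / ε) (1 / ε) r :=
    ((hasDerivAt_id r).sub_const c).div_const ε
  have h3 := h1.comp r h2
  rw [one_div, mul_comm] at h3
  exact h3

/-- The substitution `r = c + ε x` moves `ε` into the argument of `p`. The right side makes sense at
`ε = 0`, so the limit of the mollification becomes plain continuity in `ε`. -/
theorem integral_deriv_smoothTransition_scaled {p : ℝ → ℝ} {c ε : ℝ} (hc : 0 < c) (hε : 0 < ε) :
    ∫ r in Ioi (0 : ℝ), ε⁻¹ * deriv smoothTransition ((r - c) / ε) * p r =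
      ∫ x in (0 : ℝ)..1, deriv smoothTransition x * p (c + ε * x) := by
  have h1 : ∫ r in Ioi (0 : ℝ), ε⁻¹ * deriv smoothTransition ((r - c) / ε) * p r =
      ∫ r in c..c + ε, ε⁻¹ * deriv smoothTransition ((r - c) / ε) * p r := by
    rw [intervalIntegral.integral_of_le (by linarith)]
    refine setIntegral_eq_of_subset_of_forall_sdiff_eq_zero measurableSet_Ioi
      (fun r (hr : r ∈ Ioc c (c + ε)) => hc.trans hr.1) fun r hr => ?_
    rw [deriv_smoothTransition_eq_zero, mul_zero, zero_mul]
    rintro ⟨h3, h4⟩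
    rw [div_lt_one hε] at h4
    have h3 : 0 < r - c := by
      rcases div_pos_iff.1 h3 with h | h
      · exact h.1
      · linarith [h.2]
    exact hr.2 ⟨by linarith, by linarith⟩
  have h2 := intervalIntegral.smul_integral_comp_add_mul (a := 0) (b := 1)
    (fun r => ε⁻¹ * deriv smoothTransition ((r - c) / ε) * p r) ε c
  rw [mul_zero, mul_one, add_zero] at h2
  rw [h1, ← h2, smul_eq_mul, ← intervalIntegral.integral_const_mul]
  refine intervalIntegral.integral_congr fun x _ => ?_
  simp only [add_sub_cancel_left]
  rw [mul_div_cancel_left₀ _ hε.ne']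
  field_simp

theorem tendsto_integral_deriv_smoothTransition {p : ℝ → ℝ} (hp : Continuous p) {c : ℝ} :
    Tendsto (fun ε : ℝ => ∫ x in (0 : ℝ)..1, deriv smoothTransition x * p (c + ε * x))
      (𝓝 0) (𝓝 (p c)) := by
  have h : Continuous fun ε : ℝ =>
      ∫ x in (0 : ℝ)..1, deriv smoothTransition x * p (c + ε * x) := by
    refine intervalIntegral.continuous_parametric_intervalIntegral_of_continuous' ?_ _ _
    have := continuous_deriv_smoothTransition
    fun_prop
  have h0 := h.tendsto 0
  simpa [integral_deriv_smoothTransition] using h0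

theorem tendsto_smoothTransition_scaled {c r : ℝ} {ε : ℕ → ℝ} (hε : ∀ n, 0 < ε n)
    (hε0 : Tendsto ε atTop (𝓝 0)) :
    Tendsto (fun n => smoothTransition ((r - c) / ε n)) atTop
      (𝓝 ((Ioi c).indicator (fun _ => 1) r)) := by
  by_cases hr : c < r
  · rw [indicator_of_mem (mem_Ioi.2 hr)]
    refine tendsto_const_nhds.congr' ?_
    filter_upwards [hε0.eventually (gt_mem_nhds (sub_pos.2 hr))] with n hn
    rw [smoothTransition.one_of_one_le]
    rw [le_div_iff₀ (hε n)]
    linarith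
  · rw [indicator_of_notMem (s := Ioi c) hr]
    refine tendsto_const_nhds.congr fun n => ?_
    rw [smoothTransition.zero_of_nonpos]
    exact div_nonpos_of_nonpos_of_nonneg (by linarith) (hε n).le

/-- A continuous function with a locally integrable distributional derivative on `(0, ∞)` is the
integral of that derivative. -/
theorem sub_eq_integral_of_weakDeriv {p g : ℝ → ℝ} (hp : Continuous p)
    (hg : ∀ T : ℝ, 0 < T → IntegrableOn g (Ioc 0 T))
    (hpg : ∀ φ : ℝ → ℝ, ContDiff ℝ ∞ φ → HasCompactSupport φ → tsupport φ ⊆ Ioi 0 →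
      ∫ t in Ioi (0 : ℝ), deriv φ t * p t = -∫ t in Ioi (0 : ℝ), φ t * g t)
    {s t : ℝ} (hs : 0 < s) (hst : s ≤ t) :
    p t - p s = ∫ r in Ioc s t, g r := by
  set ε : ℕ → ℝ := fun n => 1 / ((n : ℝ) + 1) with hεdef
  have hε : ∀ n, 0 < ε n := fun n => by positivity
  have hε1 : ∀ n, ε n ≤ 1 := fun n => by
    rw [hεdef, div_le_one (by positivity)]
    linarith [(Nat.cast_nonneg n : (0 : ℝ) ≤ n)]
  have hε0 : Tendsto ε atTop (𝓝 0) := tendsto_one_div_add_atTop_nhds_zero_nat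
  -- Smooth approximations of the indicator of `(s, t]`. Both steps rise to the right of `s` and
  -- `t`, so the support stays in `[s, t + ε n] ⊆ (0, ∞)`, and `φ n'` tends to the Dirac mass at `s`
  -- minus the one at `t`.
  set φ : ℕ → ℝ → ℝ := fun n r =>
    smoothTransition ((r - s) / ε n) - smoothTransition ((r - t) / ε n) with hφdef
  have hφ0 : ∀ n r, r ∉ Ioc s (t + ε n) → φ n r = 0 := by
    intro n r hr
    simp only [hφdef]
    rcases le_or_gt r s with h | h
    · rw [smoothTransition.zero_of_nonpos, smoothTransition.zero_of_nonpos, sub_zero]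
      · exact div_nonpos_of_nonpos_of_nonneg (by linarith) (hε n).le
      · exact div_nonpos_of_nonpos_of_nonneg (by linarith) (hε n).le
    · have h' : t + ε n < r := by
        by_contra! h'
        exact hr ⟨h, h'⟩
      rw [smoothTransition.one_of_one_le, smoothTransition.one_of_one_le, sub_self]
      · rw [le_div_iff₀ (hε n)]; linarith
      · rw [le_div_iff₀ (hε n)]; linarith
  have hφ1 : ∀ n r, |φ n r| ≤ 1 := by
    intro n r
    simp only [hφdef]
    rw [abs_le]
    constructor <;>
      linarith [smoothTransition.nonneg ((r - s) / ε n), smoothTransition.nonneg ((r - t) / ε n),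
        smoothTransition.le_one ((r - s) / ε n), smoothTransition.le_one ((r - t) / ε n)]
  have hsupp : ∀ n, tsupport (φ n) ⊆ Icc s (t + ε n) := by
    intro n
    refine closure_minimal (fun r hr => ?_) isClosed_Icc
    by_contra h
    exact hr (hφ0 n r fun h' => h (Ioc_subset_Icc_self h'))
  have hsmooth : ∀ n, ContDiff ℝ ∞ (φ n) := by
    intro n
    have hσ : ContDiff ℝ ∞ smoothTransition := smoothTransition.contDiff
    exact (hσ.comp ((contDiff_id.sub contDiff_const).div_const _)).sub
      (hσ.comp ((contDiff_id.sub contDiff_const).div_const _))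
  have hint : ∀ c n, IntegrableOn
      (fun r => (ε n)⁻¹ * deriv smoothTransition ((r - c) / ε n) * p r) (Ioi 0) := by
    intro c n
    have hcont : Continuous
        (fun r => (ε n)⁻¹ * deriv smoothTransition ((r - c) / ε n) * p r) := by
      have := continuous_deriv_smoothTransition
      fun_prop
    refine (hcont.integrable_of_hasCompactSupport ?_).integrableOn
    refine HasCompactSupport.intro (isCompact_Icc (a := c) (b := c + ε n)) fun r hr => ?_
    rw [deriv_smoothTransition_eq_zero, mul_zero, zero_mul]
    rintro ⟨h3, h4⟩
    rw [div_lt_one (hε n)] at h4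
    have h3 : 0 < r - c := by
      rcases div_pos_iff.1 h3 with h | h
      · exact h.1
      · linarith [h.2, hε n]
    exact hr ⟨by linarith, by linarith⟩
  have hkey : ∀ n, (∫ x in (0 : ℝ)..1, deriv smoothTransition x * p (s + ε n * x)) -
      (∫ x in (0 : ℝ)..1, deriv smoothTransition x * p (t + ε n * x)) =
      -∫ r in Ioi (0 : ℝ), φ n r * g r := by
    intro n
    rw [← hpg (φ n) (hsmooth n) (HasCompactSupport.of_support_subset_isCompact isCompact_Icc
        ((subset_tsupport _).trans (hsupp n)))
      ((hsupp n).trans fun r hr => hs.trans_le hr.1),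
      ← integral_deriv_smoothTransition_scaled hs (hε n),
      ← integral_deriv_smoothTransition_scaled (hs.trans_le hst) (hε n),
      ← integral_sub (hint s n) (hint t n)]
    refine integral_congr_ae (Eventually.of_forall fun r => ?_)
    simp only
    rw [← sub_mul]
    congr 1
    exact (((hasDerivAt_smoothTransition_scaled s (ε n) r).sub
      (hasDerivAt_smoothTransition_scaled t (ε n) r)).deriv).symm
  have hL : Tendsto (fun n =>
      (∫ x in (0 : ℝ)..1, deriv smoothTransition x * p (s + ε n * x)) -
      (∫ x in (0 : ℝ)..1, deriv smoothTransition x * p (t + ε n * x))) atTop (𝓝 (p s - p t)) :=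
    ((tendsto_integral_deriv_smoothTransition hp).comp hε0).sub
      ((tendsto_integral_deriv_smoothTransition hp).comp hε0)
  have hgT := hg (t + 1) (by linarith)
  have hR : Tendsto (fun n => ∫ r in Ioi (0 : ℝ), φ n r * g r) atTop
      (𝓝 (∫ r in Ioi (0 : ℝ), (Ioc s t).indicator g r)) := by
    have hφg : ∀ n r, r ∈ Ioi (0 : ℝ) → φ n r * g r = φ n r * (Ioc 0 (t + 1)).indicator g r := by
      intro n r hr
      by_cases h : r ∈ Ioc 0 (t + 1)
      · rw [indicator_of_mem h]
      · rw [indicator_of_notMem h, hφ0 n r, zero_mul, zero_mul]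
        exact fun h' => h ⟨hr, h'.2.trans (by linarith [hε1 n])⟩
    have hgi : Integrable ((Ioc 0 (t + 1)).indicator g) (volume.restrict (Ioi 0)) :=
      (hgT.integrable_indicator measurableSet_Ioc).restrict
    refine (tendsto_integral_of_dominated_convergence (F := fun n r =>
      φ n r * (Ioc 0 (t + 1)).indicator g r) (fun r => ‖(Ioc 0 (t + 1)).indicator g r‖)
      (fun n => ?_) hgi.norm (fun n => Eventually.of_forall fun r => ?_)
      (Eventually.of_forall fun r => ?_)).congr fun n =>
        (setIntegral_congr_fun measurableSet_Ioi (hφg n)).symm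
    · exact (hsmooth n).continuous.aestronglyMeasurable.mul hgi.aestronglyMeasurable
    · rw [norm_mul]
      exact mul_le_of_le_one_left (norm_nonneg _) (hφ1 n r)
    · have h := ((tendsto_smoothTransition_scaled (c := s) (r := r) hε hε0).sub
        (tendsto_smoothTransition_scaled (c := t) (r := r) hε hε0)).mul_const
          ((Ioc 0 (t + 1)).indicator g r)
      convert h using 2
      by_cases h1 : s < r <;> by_cases h2 : t < r
      · simp [indicator, h1, h2]
      · have h3 : 0 < r := hs.trans h1
        have h4 : r ≤ t := not_lt.1 h2
        have h5 : r ≤ t + 1 := by linarith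
        simp [indicator, h1, h2, h3, h4, h5]
      · linarith
      · simp [indicator, h1, h2]
  have hfin := tendsto_nhds_unique (hL.congr hkey) hR.neg
  rw [setIntegral_indicator measurableSet_Ioc,
    inter_eq_right.2 (fun r hr => mem_Ioi.2 (hs.trans hr.1))] at hfin
  linarith

end WeakDerivative

/-! ### The energy inequality. -/

section Energy

variable {V H : Type*} [NormedAddCommGroup V] [NormedSpace ℝ V]
  [NormedAddCommGroup H] [InnerProductSpace ℝ H]

/-- The energy inequality `‖u(τ)‖² - ‖u(s)‖² ≤ 2 ∫_s^τ ⟨u_t, u⟩ dt` for `u` continuous with values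
in `H`, square integrable with values in `V`, and with derivative square integrable with values
in the dual of `V`. -/
theorem energy_inequality (j : V → H) {u : ℝ → H} (hu : Continuous u) {U : ℝ → V}
    {G : ℝ → StrongDual ℝ V} (hU : MemL2Loc U) (hG : MemL2Loc G)
    (hUu : ∀ᵐ t ∂(volume.restrict (Ioi (0 : ℝ))), j (U t) = u t)
    (hderiv : ∀ (w : V) (s t : ℝ), 0 < s → s ≤ t →
      inner ℝ (u t) (j w) - inner ℝ (u s) (j w) = ∫ r in Ioc s t, G r w)
    {s τ : ℝ} (hs : 0 ≤ s) (hsτ : s ≤ τ) :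
    ‖u τ‖ ^ 2 - ‖u s‖ ^ 2 ≤ 2 * ∫ t in Ioc s τ, G t (U t) := by
  set I : Set ℝ := Ioc 0 (τ + 1) with hI
  have hTpos : (0 : ℝ) < τ + 1 := by linarith
  -- Extension by zero makes translation in `L²` of the whole line available; the margin `1` in `I`
  -- leaves room for shifts `h < 1`.
  set w : ℝ → V := I.indicator U with hw
  set g : ℝ → StrongDual ℝ V := I.indicator G with hg
  have hwL : MemLp w 2 volume := (memLp_indicator_iff_restrict measurableSet_Ioc).2 (hU _ hTpos)
  have hgL : MemLp g 2 volume := (memLp_indicator_iff_restrict measurableSet_Ioc).2 (hG _ hTpos)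
  set y : ℝ → ℝ := fun t => ‖u t‖ ^ 2 with hy
  have hyc : Continuous y := by fun_prop
  set B : ℝ × ℝ → ℝ := fun p => ∫ t in Ioc s τ, g (t + p.1) (w (t + p.2)) with hB
  have hBc : Continuous B := continuous_translate_pairing hgL hwL _
  have hB0 : B 0 = ∫ t in Ioc s τ, G t (U t) := by
    refine setIntegral_congr_fun measurableSet_Ioc fun t ht => ?_
    have htI : t ∈ I := ⟨hs.trans_lt ht.1, by linarith [ht.2]⟩
    simp only [Prod.fst_zero, Prod.snd_zero, add_zero, hg, hw, indicator_of_mem htI]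
  have hUu' : ∀ᵐ t : ℝ, 0 < t → j (U t) = u t := (ae_restrict_iff' measurableSet_Ioi).1 hUu
  set F : ℝ → ℝ := fun h => ∫ t in s..τ, y (t + h) with hF
  have hFderiv : HasDerivAt F (y τ - y s) 0 := by
    have h1 : ∀ h, F h = (∫ t in (0 : ℝ)..(τ + h), y t) - ∫ t in (0 : ℝ)..(s + h), y t := by
      intro h
      rw [hF]
      simp only
      rw [intervalIntegral.integral_comp_add_right,
        intervalIntegral.integral_interval_sub_left (hyc.intervalIntegrable _ _)
          (hyc.intervalIntegrable _ _)]
    have h2 : ∀ c : ℝ, HasDerivAt (fun h => ∫ t in (0 : ℝ)..(c + h), y t) (y c) 0 := by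
      intro c
      have h3 := (hyc.integral_hasStrictDerivAt 0 (c + 0)).hasDerivAt.comp_const_add c 0
      simpa using h3
    rw [funext h1]
    exact (h2 τ).sub (h2 s)
  -- From `‖b‖² - ‖a‖² = 2⟨b - a, b⟩ - ‖b - a‖²` with `b = u(t + h)`, `a = u(t)`: the last term is
  -- dropped, and `⟨b - a, b⟩` is the integral of `u_t` against the frozen vector `U(t + h)`. Fubini
  -- then exchanges `t` and `r`.
  have hle : ∀ h ∈ Ioo (0 : ℝ) 1, F h - F 0 ≤ 2 * ∫ r in Ioc 0 h, B (r, h) := by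
    intro h hh
    have hFub := integral_translate_pairing_comm hgL hwL (Ioc s τ) h
    simp only [hB, ← hFub, hF]
    rw [intervalIntegral.integral_of_le hsτ, intervalIntegral.integral_of_le hsτ,
      ← integral_sub ((by fun_prop : Continuous fun t => y (t + h)).integrableOn_Ioc)
        ((by fun_prop : Continuous fun t => y (t + 0)).integrableOn_Ioc), ← integral_const_mul]
    have hshift : ∀ᵐ t : ℝ, 0 < t + h → j (U (t + h)) = u (t + h) :=
      (measurePreserving_add_right volume h).quasiMeasurePreserving.ae hUu'
    have hinner : ∀ᵐ t ∂(volume.restrict (Ioc s τ)),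
        ∫ r in Ioc 0 h, g (t + r) (w (t + h)) =
          inner ℝ (u (t + h)) (u (t + h)) - inner ℝ (u t) (u (t + h)) := by
      rw [ae_restrict_iff' measurableSet_Ioc]
      filter_upwards [hshift] with t ht htI
      have ht0 : 0 < t := hs.trans_lt htI.1
      have hth : t + h ∈ I := ⟨by linarith [hh.1], by linarith [hh.2, htI.2]⟩
      have := hderiv (U (t + h)) t (t + h) ht0 (by linarith [hh.1])
      rw [ht hth.1] at this
      rw [this, ← intervalIntegral.integral_of_le hh.1.le,
        ← intervalIntegral.integral_of_le (by linarith [hh.1] : t ≤ t + h)]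
      have hsub := intervalIntegral.integral_comp_add_left (a := 0) (b := h)
        (fun r => G r (U (t + h))) t
      rw [add_zero] at hsub
      rw [← hsub]
      refine intervalIntegral.integral_congr_ae (Eventually.of_forall fun r hr => ?_)
      rw [uIoc_of_le hh.1.le] at hr
      have hr' : t + r ∈ I := ⟨by linarith [hr.1], by linarith [hr.2, hth.2]⟩
      simp only [hg, hw, indicator_of_mem hr', indicator_of_mem hth]
    refine integral_mono_ae ?_ ?_ ?_
    · exact ((by fun_prop : Continuous fun t => y (t + h) - y (t + 0)).integrableOn_Ioc)
    · refine Integrable.congr ?_ (hinner.mono fun t ht => (congrArg (fun x => 2 * x) ht).symm)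
      exact ((by fun_prop : Continuous fun t => 2 * (inner ℝ (u (t + h)) (u (t + h)) -
        inner ℝ (u t) (u (t + h)))).integrableOn_Ioc)
    · filter_upwards [hinner] with t ht
      rw [ht]
      have h3 := norm_sub_sq_real (u (t + h)) (u t)
      have h4 : inner ℝ (u (t + h)) (u (t + h)) = ‖u (t + h)‖ ^ 2 := real_inner_self_eq_norm_sq _
      rw [real_inner_comm] at h3
      simp only [hy, add_zero]
      rw [h4]
      nlinarith [sq_nonneg ‖u (t + h) - u t‖]
  rw [← hB0]
  change y τ - y s ≤ 2 * B 0
  refine le_of_forall_pos_le_add fun δ hδ => ?_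
  have hBev : ∀ᶠ p in 𝓝 (0 : ℝ × ℝ), B p < B 0 + δ / 2 :=
    hBc.continuousAt.eventually (gt_mem_nhds (by linarith))
  obtain ⟨η, hη, hball⟩ := Metric.eventually_nhds_iff.1 hBev
  -- Dividing by `h ↓ 0`: the left side tends to `F'(0) = y τ - y s`, while the mean of `B(r, h)`
  -- over `0 < r ≤ h` is at most `B 0 + δ / 2` for small `h`.
  have hslope := (hasDerivAt_iff_tendsto_slope_zero.1 hFderiv).mono_left
    (nhdsWithin_mono 0 (s := Ioi 0) fun x hx => ne_of_gt hx)
  refine le_of_tendsto hslope ?_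
  have hmem : Ioo (0 : ℝ) (min 1 η) ∈ 𝓝[>] (0 : ℝ) :=
    Ioo_mem_nhdsGT (lt_min one_pos hη)
  filter_upwards [hmem] with h hh
  have h1 := hle h ⟨hh.1, hh.2.trans_le (min_le_left _ _)⟩
  have h2 : ∫ r in Ioc 0 h, B (r, h) ≤ ∫ _r in Ioc 0 h, (B 0 + δ / 2) := by
    refine setIntegral_mono_on
      ((by fun_prop : Continuous fun r => B (r, h)).integrableOn_Ioc) (by simp)
      measurableSet_Ioc fun r hr => (hball ?_).le
    have hη' := hh.2.trans_le (min_le_right 1 η)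
    rw [dist_zero_right, Prod.norm_def, max_lt_iff, Real.norm_of_nonneg hr.1.le,
      Real.norm_of_nonneg hh.1.le]
    exact ⟨hr.2.trans_lt hη', hη'⟩
  rw [setIntegral_const, smul_eq_mul, Real.volume_real_Ioc_of_le hh.1.le, sub_zero] at h2
  rw [zero_add, smul_eq_mul, inv_mul_le_iff₀ hh.1]
  nlinarith

end Energy

/-! ### Integrating the differential inequality. -/

section Comparison

/-- A function whose decrements over short intervals are of second order does not decrease. -/
theorem le_of_sub_ge_mul_variation {f y : ℝ → ℝ} {K T : ℝ} (hT : 0 ≤ T)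
    (h : ∀ s t, 0 ≤ s → s ≤ t → t ≤ T → -(K * (t - s) * (y s - y t)) ≤ f t - f s) :
    f 0 ≤ f T := by
  have hn : ∀ n : ℕ, f 0 - K * T * (y 0 - y T) * (1 / ((n : ℝ) + 1)) ≤ f T := by
    intro n
    set d : ℝ := T / ((n : ℝ) + 1) with hd
    have hn0 : (0 : ℝ) < (n : ℝ) + 1 := by positivity
    have hd0 : 0 ≤ d := by positivity
    have hdT : ((n : ℝ) + 1) * d = T := by rw [hd]; field_simp
    -- On a uniform partition the differences of `y` telescope, leaving a total error `K * d * (y 0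
    -- - y T)`, which vanishes with the mesh `d`.
    have hk : ∀ k : ℕ, k ≤ n + 1 → f 0 - K * d * (y 0 - y (k * d)) ≤ f (k * d) := by
      intro k
      induction k with
      | zero => intro _; simp
      | succ k ih =>
        intro hk
        have h1 := ih (by omega)
        have hk' : ((k + 1 : ℕ) : ℝ) ≤ (n : ℝ) + 1 := by exact_mod_cast hk
        have h2 := h (k * d) ((k + 1 : ℕ) * d) (by positivity)
          (by push_cast; nlinarith) (hdT ▸ mul_le_mul_of_nonneg_right hk' hd0)
        have h3 : ((k + 1 : ℕ) : ℝ) * d - k * d = d := by push_cast; ring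
        rw [h3] at h2
        linarith
    have h4 := hk (n + 1) le_rfl
    push_cast at h4
    rw [hdT] at h4
    have h5 : K * T * (y 0 - y T) * (1 / ((n : ℝ) + 1)) = K * d * (y 0 - y T) := by
      rw [hd]; ring
    rw [h5]
    exact h4
  have hlim : Tendsto (fun n : ℕ => f 0 - K * T * (y 0 - y T) * (1 / ((n : ℝ) + 1))) atTop
      (𝓝 (f 0 - K * T * (y 0 - y T) * 0)) :=
    (tendsto_one_div_add_atTop_nhds_zero_nat.const_mul _).const_sub _
  rw [mul_zero, sub_zero] at hlim
  exact le_of_tendsto hlim (Eventually.of_forall hn)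

/-- If `y` decreases at least at the rate `κ Λ(y)`, then `y > 0` at most up to the time
`κ⁻¹ ∫_0^{y(0)} dh / Λ(h)`. -/
theorem mul_time_le_lintegral_inv {Λ : ℝ → ℝ≥0∞} {y : ℝ → ℝ} {κ : ℝ} (hκ : 0 < κ)
    (hmono : ∀ h h', 0 < h → h ≤ h' → Λ h ≤ Λ h')
    (hsub : ∀ h h', 0 < h → h ≤ h' → Λ h' ≤ ENNReal.ofReal (h' / h) * Λ h)
    (hpos : ∀ h, 0 < h → Λ h ≠ 0) (hfin : ∀ h, 0 < h → Λ h ≠ ⊤)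
    (hanti : ∀ s t, 0 ≤ s → s ≤ t → y t ≤ y s)
    (hy : ∀ s t, 0 ≤ s → s ≤ t → 0 < y t → κ * (t - s) * (Λ (y t)).toReal ≤ y s - y t)
    {T : ℝ} (hT : 0 ≤ T) (hyT : 0 < y T) :
    ENNReal.ofReal (κ * T) ≤ ∫⁻ h in Ioc 0 (y 0), (Λ h)⁻¹ := by
  set L : ℝ → ℝ := fun h => (Λ h).toReal with hL
  have hLpos : ∀ h, 0 < h → 0 < L h := fun h hh => ENNReal.toReal_pos (hpos h hh) (hfin h hh)
  have hLmono : ∀ h h', 0 < h → h ≤ h' → L h ≤ L h' := fun h h' hh hhh' =>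
    ENNReal.toReal_mono (hfin h' (hh.trans_le hhh')) (hmono h h' hh hhh')
  have hLsub : ∀ h h', 0 < h → h ≤ h' → L h' ≤ h' / h * L h := by
    intro h h' hh hhh'
    have h1 := ENNReal.toReal_mono (ENNReal.mul_ne_top ENNReal.ofReal_ne_top (hfin h hh))
      (hsub h h' hh hhh')
    rwa [ENNReal.toReal_mul, ENNReal.toReal_ofReal (div_nonneg (hh.le.trans hhh') hh.le)] at h1
  have hψ : AntitoneOn (fun h => (L h)⁻¹) (Ioi 0) := fun h hh h' _ hhh' =>
    inv_anti₀ (hLpos h hh) (hLmono h h' hh hhh')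
  have hint : ∀ b c, 0 < b → 0 < c → IntervalIntegrable (fun h => (L h)⁻¹) volume b c :=
    fun b c hb hc => (hψ.mono fun x hx => (lt_min hb hc).trans_le hx.1).intervalIntegrable
  have hypos : ∀ t, 0 ≤ t → t ≤ T → 0 < y t := fun t ht htT => hyT.trans_le (hanti t T ht htT)
  -- The integral over `[y t, y s]` is bounded below with `L (y s)`, whereas the decay involves `L
  -- (y t)`. Exchanging them costs the factor `y t / y s ≥ 1 - (y s - y t) / y T`, a second-order
  -- error with `K = κ / y T`.
  have hf := le_of_sub_ge_mul_variation (f := fun t => (∫ h in y t..y 0, (L h)⁻¹) - κ * t)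
    (y := y) (K := κ / y T) hT (by
      intro s t hs hst htT
      have hyt := hypos t (hs.trans hst) htT
      have hys := hypos s hs (hst.trans htT)
      have hyts := hanti s t hs hst
      have hy0 := hypos 0 le_rfl hT
      have hyTs := hanti s T hs (hst.trans htT)
      have h1 : (∫ h in y t..y 0, (L h)⁻¹) - ∫ h in y s..y 0, (L h)⁻¹ =
          ∫ h in y t..y s, (L h)⁻¹ := by
        rw [sub_eq_iff_eq_add]
        exact (intervalIntegral.integral_add_adjacent_intervals (hint _ _ hyt hys)
          (hint _ _ hys hy0)).symm
      have h2 : (y s - y t) * (L (y s))⁻¹ ≤ ∫ h in y t..y s, (L h)⁻¹ := by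
        rw [← smul_eq_mul, ← intervalIntegral.integral_const]
        exact intervalIntegral.integral_mono_on hyts (by simp) (hint _ _ hyt hys)
          fun h hh => hψ (hyt.trans_le hh.1) hys hh.2
      have h3 := hy s t hs hst hyt
      have h4 := hLsub (y t) (y s) hyt hyts
      have hLs := hLpos _ hys
      have h5 : κ * (t - s) * (y t / y s) ≤ (y s - y t) * (L (y s))⁻¹ := by
        rw [← div_eq_mul_inv, le_div_iff₀ hLs]
        have h6 : y t / y s * L (y s) ≤ L (y t) := by
          rw [div_mul_eq_mul_div, div_le_iff₀ hys]
          rw [div_mul_eq_mul_div, le_div_iff₀ hyt] at h4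
          linarith
        have h7 : 0 ≤ κ * (t - s) := mul_nonneg hκ.le (by linarith)
        calc κ * (t - s) * (y t / y s) * L (y s) = κ * (t - s) * (y t / y s * L (y s)) := by ring
          _ ≤ κ * (t - s) * L (y t) := mul_le_mul_of_nonneg_left h6 h7
          _ ≤ y s - y t := h3
      have h8 : 1 - (y s - y t) / y T ≤ y t / y s := by
        have h9 : y t / y s = 1 - (y s - y t) / y s := by field_simp; ring
        rw [h9]
        have : (y s - y t) / y s ≤ (y s - y t) / y T :=
          div_le_div_of_nonneg_left (by linarith) hyT hyTs
        linarith
      have h10 := mul_le_mul_of_nonneg_left h8 (mul_nonneg hκ.le (by linarith : 0 ≤ t - s))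
      have h11 : κ * (t - s) * (1 - (y s - y t) / y T) =
          κ * (t - s) - κ / y T * (t - s) * (y s - y t) := by ring
      linarith)
  simp only [intervalIntegral.integral_same, mul_zero, sub_zero] at hf
  have hyT0 := hanti 0 T le_rfl hT
  have hy0 := hypos 0 le_rfl hT
  calc ENNReal.ofReal (κ * T) ≤ ENNReal.ofReal (∫ h in y T..y 0, (L h)⁻¹) :=
        ENNReal.ofReal_le_ofReal (by linarith)
    _ = ∫⁻ h in Ioc (y T) (y 0), ENNReal.ofReal ((L h)⁻¹) := by
        rw [intervalIntegral.integral_of_le hyT0]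
        refine ofReal_integral_eq_lintegral_ofReal ?_ (Eventually.of_forall fun h => ?_)
        · exact (intervalIntegrable_iff_integrableOn_Ioc_of_le hyT0).1 (hint _ _ hyT hy0)
        · exact inv_nonneg.2 ENNReal.toReal_nonneg
    _ = ∫⁻ h in Ioc (y T) (y 0), (Λ h)⁻¹ := by
        refine setLIntegral_congr_fun measurableSet_Ioc fun h hh => ?_
        have hh0 := hyT.trans hh.1
        rw [ENNReal.ofReal_inv_of_pos (hLpos h hh0), ENNReal.ofReal_toReal (hfin h hh0)]
    _ ≤ ∫⁻ h in Ioc 0 (y 0), (Λ h)⁻¹ :=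
        lintegral_mono_set (Ioc_subset_Ioc_left hyT.le)

end Comparison

/-! ### Scaling of `λ₁` and its bound by the dissipation. -/

section Functional

variable {N m : ℕ} {Ω : Set (EuclideanSpace ℝ (Fin N))}

theorem W0.D_smul (σ : ℝ) (v : W0 m Ω) (α : MultiIndex N m) :
    W0.D (σ • v) α = σ • W0.D v α := rfl

theorem W0.fn_smul (σ : ℝ) (v : W0 m Ω) : W0.fn (σ • v) = σ • W0.fn v := rfl

theorem W0.topSq_nonneg (v : W0 m Ω) (x : EuclideanSpace ℝ (Fin N)) : 0 ≤ W0.topSq v x :=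
  Finset.sum_nonneg fun _ _ => by positivity

theorem W0.topSq_smul_ae (σ : ℝ) (v : W0 m Ω) :
    ∀ᵐ x ∂(volume.restrict Ω), W0.topSq (σ • v) x = σ ^ 2 * W0.topSq v x := by
  have h : ∀ᵐ x ∂(volume.restrict Ω), ∀ α : TopIndex N m,
      W0.D (σ • v) α.1 x = σ * W0.D v α.1 x :=
    ae_all_iff.2 fun α => Lp.coeFn_smul σ (W0.D v α.1)
  filter_upwards [h] with x hx
  simp only [W0.topSq, hx, Finset.mul_sum, abs_mul, mul_pow, sq_abs]

theorem integrable_W0_topSq (v : W0 m Ω) : Integrable (W0.topSq v) (volume.restrict Ω) := by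
  refine integrable_finsetSum _ fun α _ => ?_
  simp only [sq_abs]
  exact (Lp.memLp (W0.D v α.1)).integrable_sq

theorem lintegral_energy_smul_le {a : EuclideanSpace ℝ (Fin N) → ℝ} {q : ℝ}
    (hΩ : MeasurableSet Ω) (ha : ∀ x ∈ Ω, 0 ≤ a x) {σ c : ℝ} (hσ : 0 ≤ σ) (h2 : σ ^ 2 ≤ c)
    (hq : σ ^ (1 + q) ≤ c) (v : W0 m Ω) :
    ∫⁻ x in Ω, ENNReal.ofReal (W0.topSq (σ • v) x + a x * |W0.fn (σ • v) x| ^ (1 + q)) ≤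
      ENNReal.ofReal c *
        ∫⁻ x in Ω, ENNReal.ofReal (W0.topSq v x + a x * |W0.fn v x| ^ (1 + q)) := by
  have hc : 0 ≤ c := (sq_nonneg σ).trans h2
  rw [← lintegral_const_mul' _ _ ENNReal.ofReal_ne_top]
  refine lintegral_mono_ae ?_
  filter_upwards [W0.topSq_smul_ae σ v, Lp.coeFn_smul σ (W0.fn v), ae_restrict_mem hΩ]
    with x h3 h4 hx
  rw [← ENNReal.ofReal_mul hc]
  refine ENNReal.ofReal_le_ofReal ?_
  rw [h3, W0.fn_smul, h4, Pi.smul_apply, smul_eq_mul, abs_mul, abs_of_nonneg hσ,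
    Real.mul_rpow hσ (abs_nonneg _), mul_add]
  have h5 : 0 ≤ a x * |W0.fn v x| ^ (1 + q) := mul_nonneg (ha x hx) (by positivity)
  have h6 := mul_le_mul_of_nonneg_right hq h5
  have h7 := mul_le_mul_of_nonneg_right h2 (W0.topSq_nonneg v x)
  linarith

theorem lambda1_sq_mul_le {a : EuclideanSpace ℝ (Fin N) → ℝ} {q : ℝ}
    (hΩ : MeasurableSet Ω) (ha : ∀ x ∈ Ω, 0 ≤ a x) {σ c : ℝ} (hσ : 0 < σ) (h2 : σ ^ 2 ≤ c)
    (hq : σ ^ (1 + q) ≤ c) (h : ℝ) :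
    lambda1 m Ω a q (σ ^ 2 * h) ≤ ENNReal.ofReal c * lambda1 m Ω a q h := by
  have hc : 0 < c := lt_of_lt_of_le (by positivity) h2
  have hc0 : ENNReal.ofReal c ≠ 0 := (ENNReal.ofReal_pos.2 hc).ne'
  simp only [lambda1]
  -- Here `c > 0` matters: an infimum without competitors is `⊤`, and `0 * ⊤ = 0`.
  rw [ENNReal.mul_iInf_of_ne hc0 ENNReal.ofReal_ne_top]
  refine le_iInf fun v => ?_
  rw [ENNReal.mul_iInf_of_ne hc0 ENNReal.ofReal_ne_top]
  refine le_iInf fun hv => ?_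
  refine (iInf₂_le (σ • v) ?_).trans (lintegral_energy_smul_le hΩ ha hσ.le h2 hq v)
  rw [W0.fn_smul, norm_smul, mul_pow, hv, Real.norm_eq_abs, sq_abs]

theorem lambda1_mono {a : EuclideanSpace ℝ (Fin N) → ℝ} {q : ℝ} (hq : 0 < q)
    (hΩ : MeasurableSet Ω) (ha : ∀ x ∈ Ω, 0 ≤ a x) {h h' : ℝ} (hh : 0 < h) (hhh' : h ≤ h') :
    lambda1 m Ω a q h ≤ lambda1 m Ω a q h' := by
  have hh' := hh.trans_le hhh'
  have h1 : √(h / h') ≤ 1 := by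
    rw [← Real.sqrt_one]
    exact Real.sqrt_le_sqrt ((div_le_one hh').2 hhh')
  have h2 : √(h / h') ^ 2 * h' = h := by
    rw [Real.sq_sqrt (by positivity), div_mul_cancel₀ _ hh'.ne']
  -- Shrinking by `σ = √(h / h') ≤ 1` decreases both terms of the energy, so `c = 1`.
  have h3 := lambda1_sq_mul_le (m := m) (q := q) hΩ ha (Real.sqrt_pos.2 (div_pos hh hh'))
    (pow_le_one₀ (Real.sqrt_nonneg _) h1)
    (Real.rpow_le_one (Real.sqrt_nonneg _) h1 (by linarith)) h'
  rwa [h2, ENNReal.ofReal_one, one_mul] at h3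

theorem lambda1_le_div_mul {a : EuclideanSpace ℝ (Fin N) → ℝ} {q : ℝ} (hq : q < 1)
    (hΩ : MeasurableSet Ω) (ha : ∀ x ∈ Ω, 0 ≤ a x) {h h' : ℝ} (hh : 0 < h) (hhh' : h ≤ h') :
    lambda1 m Ω a q h' ≤ ENNReal.ofReal (h' / h) * lambda1 m Ω a q h := by
  have hh' := hh.trans_le hhh'
  have h1 : 1 ≤ √(h' / h) := by
    rw [Real.one_le_sqrt, one_le_div hh]
    exact hhh'
  have h2 : √(h' / h) ^ 2 = h' / h := Real.sq_sqrt (by positivity)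
  -- For `σ = √(h' / h) ≥ 1` the quadratic term grows fastest, so `c = σ²`.
  have h3 := lambda1_sq_mul_le (m := m) (q := q) hΩ ha (Real.sqrt_pos.2 (div_pos hh' hh)) h2.le
    (by
      have h4 := Real.rpow_le_rpow_of_exponent_le h1 (by push_cast; linarith : 1 + q ≤ (2 : ℕ))
      rwa [Real.rpow_natCast, h2] at h4) h
  rwa [h2, div_mul_cancel₀ _ hh.ne'] at h3

theorem integrable_absorption {a : EuclideanSpace ℝ (Fin N) → ℝ} {q K : ℝ} (hq0 : 0 < q)
    (hq1 : q < 1) (hΩ : MeasurableSet Ω) (hΩfin : volume Ω ≠ ⊤)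
    (hameas : AEMeasurable a (volume.restrict Ω)) (ha : ∀ x ∈ Ω, 0 ≤ a x)
    (haK : ∀ x ∈ Ω, a x ≤ K) (f : L2 Ω) :
    Integrable (fun x => a x * |f x| ^ (1 + q)) (volume.restrict Ω) := by
  have : IsFiniteMeasure (volume.restrict Ω) := isFiniteMeasure_restrict.2 hΩfin
  have hf : AEMeasurable f (volume.restrict Ω) := (Lp.aestronglyMeasurable f).aemeasurable
  refine Integrable.mono' (g := fun x => K * (1 + f x ^ 2))
    (((integrable_const 1).add (Lp.memLp f).integrable_sq).const_mul K)
    (hameas.mul ((continuous_abs.measurable.comp_aemeasurable hf).pow_const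
      (1 + q))).aestronglyMeasurable ?_
  filter_upwards [ae_restrict_mem hΩ] with x hx
  have h1 : |f x| ^ (1 + q) ≤ 1 + f x ^ 2 := by
    rcases le_total |f x| 1 with h | h
    · have := Real.rpow_le_one (abs_nonneg _) h (by linarith : 0 ≤ 1 + q)
      nlinarith [sq_nonneg (f x)]
    · have := Real.rpow_le_rpow_of_exponent_le h (by push_cast; linarith : 1 + q ≤ (2 : ℕ))
      rw [Real.rpow_natCast, sq_abs] at this
      linarith
  rw [Real.norm_of_nonneg (mul_nonneg (ha x hx) (by positivity))]
  exact mul_le_mul (haK x hx) h1 (by positivity) ((ha x hx).trans (haK x hx))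

/-- A non-integrable density would have Bochner integral `0`; coercivity would then force `D^m v =
0` a.e., and the density, each of whose terms carries a factor `D^α v`, would vanish a.e. and be
integrable. -/
theorem IsCoercive.integrable_fluxDensity {A : Coeff N m} {C : ℝ} (hC : 0 < C)
    (hcoer : IsCoercive Ω A C) (v : W0 m Ω) :
    Integrable (fluxDensity A v v) (volume.restrict Ω) := by
  by_contra hni
  have h1 := hcoer v
  rw [integral_undef hni] at h1
  have h2 : ∫ x in Ω, W0.topSq v x = 0 :=
    le_antisymm (by nlinarith) (integral_nonneg (W0.topSq_nonneg v))
  rw [integral_eq_zero_iff_of_nonneg (W0.topSq_nonneg v) (integrable_W0_topSq v)] at h2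
  refine hni ((integrable_zero _ _ _).congr ?_)
  filter_upwards [h2] with x hx
  have h3 := (Finset.sum_eq_zero_iff_of_nonneg fun α _ => by positivity).1 hx
  refine (Finset.sum_eq_zero fun α hα => ?_).symm
  have h4 := h3 α hα
  simp only [sq_abs, ne_eq, OfNat.ofNat_ne_zero, not_false_eq_true, pow_eq_zero_iff] at h4
  rw [h4, mul_zero]

theorem abs_rpow_sub_one_mul_mul_self {q : ℝ} (hq : 0 < q) (r : ℝ) :
    |r| ^ (q - 1) * r * r = |r| ^ (1 + q) := by
  rcases eq_or_ne r 0 with rfl | hr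
  · rw [abs_zero, Real.zero_rpow (by linarith : 1 + q ≠ 0), mul_zero]
  · rw [mul_assoc, ← sq, ← sq_abs, ← Real.rpow_natCast, ← Real.rpow_add (abs_pos.2 hr)]
    congr 1
    push_cast
    ring

/-- `v` competes in the infimum at its own level `‖v‖²`. The constant is `min 1 C` because the
absorption term enters with factor `1` and the top-order term with factor `C`. -/
theorem lambda1_le_dissipation {a : EuclideanSpace ℝ (Fin N) → ℝ} {q K : ℝ} (hq0 : 0 < q)
    (hq1 : q < 1) (hΩ : MeasurableSet Ω) (hΩfin : volume Ω ≠ ⊤)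
    (hameas : AEMeasurable a (volume.restrict Ω)) (ha : ∀ x ∈ Ω, 0 ≤ a x)
    (haK : ∀ x ∈ Ω, a x ≤ K) {A : Coeff N m} {C : ℝ} (hC : 0 < C) (hcoer : IsCoercive Ω A C)
    (v : W0 m Ω) :
    lambda1 m Ω a q (‖W0.fn v‖ ^ 2) ≠ ⊤ ∧
      min 1 C * (lambda1 m Ω a q (‖W0.fn v‖ ^ 2)).toReal ≤
        ∫ x in Ω, (fluxDensity A v v x + a x * (|W0.fn v x| ^ (q - 1) * W0.fn v x) * W0.fn v x) := by
  have hint1 := integrable_W0_topSq v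
  have hint2 := integrable_absorption hq0 hq1 hΩ hΩfin hameas ha haK (W0.fn v)
  have hnn : ∀ᵐ x ∂(volume.restrict Ω), 0 ≤ a x * |W0.fn v x| ^ (1 + q) := by
    filter_upwards [ae_restrict_mem hΩ] with x hx
    exact mul_nonneg (ha x hx) (by positivity)
  have hE0 : 0 ≤ ∫ x in Ω, (W0.topSq v x + a x * |W0.fn v x| ^ (1 + q)) :=
    integral_nonneg_of_ae (hnn.mono fun x hx => add_nonneg (W0.topSq_nonneg v x) hx)
  have h1 : lambda1 m Ω a q (‖W0.fn v‖ ^ 2) ≤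
      ENNReal.ofReal (∫ x in Ω, (W0.topSq v x + a x * |W0.fn v x| ^ (1 + q))) := by
    rw [ofReal_integral_eq_lintegral_ofReal
      (f := fun x => W0.topSq v x + a x * |W0.fn v x| ^ (1 + q)) (hint1.add hint2)
      (hnn.mono fun x hx => add_nonneg (W0.topSq_nonneg v x) hx)]
    exact iInf_le_of_le v (iInf_le_of_le rfl le_rfl)
  have h2 := ENNReal.toReal_mono ENNReal.ofReal_ne_top h1
  rw [ENNReal.toReal_ofReal hE0] at h2
  refine ⟨ne_top_of_le_ne_top ENNReal.ofReal_ne_top h1, ?_⟩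
  have h3 : ∀ x, a x * (|W0.fn v x| ^ (q - 1) * W0.fn v x) * W0.fn v x =
      a x * |W0.fn v x| ^ (1 + q) := fun x => by
    rw [mul_assoc, abs_rpow_sub_one_mul_mul_self hq0]
  simp only [h3]
  have hκ : 0 < min 1 C := lt_min one_pos hC
  have h4 := hcoer v
  have h5 := mul_le_mul_of_nonneg_left h2 hκ.le
  rw [integral_add hint1 hint2] at h5
  rw [integral_add (hcoer.integrable_fluxDensity hC v) hint2]
  have h6 : 0 ≤ ∫ x in Ω, W0.topSq v x := integral_nonneg (W0.topSq_nonneg v)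
  have h7 : 0 ≤ ∫ x in Ω, a x * |W0.fn v x| ^ (1 + q) := integral_nonneg_of_ae hnn
  have h8 := mul_le_mul_of_nonneg_right (min_le_right 1 C) h6
  have h9 := mul_le_mul_of_nonneg_right (min_le_left 1 C) h7
  rw [mul_add] at h5
  linarith

end Functional

/-! ### Positivity of `Λ` and finiteness of the integral up to any level. -/

section Integral

/-- By monotonicity a zero at `h` spreads to all of `(0, h]`, where `1 / Λ` would be `∞` on a set of
positive measure. -/
theorem ne_zero_of_lintegral_inv_lt_top {Λ : ℝ → ℝ≥0∞}
    (hmono : ∀ h h', 0 < h → h ≤ h' → Λ h ≤ Λ h')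
    (hint : (∫⁻ h in Ioc (0 : ℝ) 1, (Λ h)⁻¹) < ⊤) {h : ℝ} (hh : 0 < h) : Λ h ≠ 0 := by
  intro h0
  refine hint.ne (top_unique ?_)
  have hpos : 0 < min h 1 := lt_min hh one_pos
  calc (⊤ : ℝ≥0∞) = ∫⁻ _x in Ioc (0 : ℝ) (min h 1), ⊤ := by
        rw [setLIntegral_const, Real.volume_Ioc, sub_zero, ENNReal.top_mul]
        exact (ENNReal.ofReal_pos.2 hpos).ne'
    _ = ∫⁻ x in Ioc (0 : ℝ) (min h 1), (Λ x)⁻¹ := by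
        refine setLIntegral_congr_fun measurableSet_Ioc fun x hx => ?_
        have : Λ x = 0 :=
          le_antisymm ((hmono x h hx.1 (hx.2.trans (min_le_left _ _))).trans_eq h0) zero_le
        rw [this, ENNReal.inv_zero]
    _ ≤ ∫⁻ x in Ioc (0 : ℝ) 1, (Λ x)⁻¹ :=
        lintegral_mono_set (Ioc_subset_Ioc_right (min_le_right _ _))

theorem lintegral_inv_lt_top {Λ : ℝ → ℝ≥0∞}
    (hmono : ∀ h h', 0 < h → h ≤ h' → Λ h ≤ Λ h')
    (hint : (∫⁻ h in Ioc (0 : ℝ) 1, (Λ h)⁻¹) < ⊤) (R : ℝ) :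
    (∫⁻ h in Ioc (0 : ℝ) R, (Λ h)⁻¹) < ⊤ := by
  have hsub : Ioc (0 : ℝ) R ⊆ Ioc 0 1 ∪ Ioc 1 R := Ioc_subset_Ioc_union_Ioc
  refine ((lintegral_mono_set hsub).trans (lintegral_union_le _ _ _)).trans_lt
    (ENNReal.add_lt_top.2 ⟨hint, ?_⟩)
  calc ∫⁻ x in Ioc (1 : ℝ) R, (Λ x)⁻¹ ≤ ∫⁻ _x in Ioc (1 : ℝ) R, (Λ 1)⁻¹ :=
        setLIntegral_mono measurable_const fun x hx =>
          ENNReal.inv_le_inv.2 (hmono 1 x one_pos hx.1.le)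
    _ < ⊤ := by
        rw [setLIntegral_const, Real.volume_Ioc]
        exact ENNReal.mul_lt_top
          (ENNReal.inv_lt_top.2 (pos_iff_ne_zero.2
            (ne_zero_of_lintegral_inv_lt_top hmono hint one_pos))) ENNReal.ofReal_lt_top

end Integral

/-! ### Decay of `‖u‖²` along weak solutions. -/

section Solution

variable {N m : ℕ} {Ω : Set (EuclideanSpace ℝ (Fin N))}

theorem IsTimeDeriv.inner_sub_inner {u : ℝ → L2 Ω} {G : ℝ → StrongDual ℝ (W0 m Ω)}
    (hu : Continuous u) (hG : MemL2Loc G) (huG : IsTimeDeriv u G) (w : W0 m Ω) {s t : ℝ}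
    (hs : 0 < s) (hst : s ≤ t) :
    inner ℝ (u t) (W0.fn w) - inner ℝ (u s) (W0.fn w) = ∫ r in Ioc s t, G r w :=
  sub_eq_integral_of_weakDeriv (p := fun t => inner ℝ (u t) (W0.fn w)) (by fun_prop)
    (fun T hT => integrable_pairing (hG T hT) (memLp_const w)) (fun φ => huG w φ) hs hst

/-- Along a weak solution `‖u‖²` decreases at least by twice the dissipated energy. -/
theorem IsWeakSolution.exists_dissipation {A : Coeff N m} {a : EuclideanSpace ℝ (Fin N) → ℝ}
    {q : ℝ} {u₀ : L2 Ω} {u : ℝ → L2 Ω} (hu : IsWeakSolution A a q u₀ u) :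
    ∃ U : ℝ → W0 m Ω, (∀ᵐ t ∂(volume.restrict (Ioi (0 : ℝ))), W0.fn (U t) = u t) ∧
      ∀ s t : ℝ, 0 ≤ s → s ≤ t →
        IntegrableOn (fun r => ∫ x in Ω, (fluxDensity A (U r) (U r) x +
          a x * (|W0.fn (U r) x| ^ (q - 1) * W0.fn (U r) x) * W0.fn (U r) x)) (Ioc s t) ∧
        2 * ∫ r in Ioc s t, ∫ x in Ω, (fluxDensity A (U r) (U r) x +
          a x * (|W0.fn (U r) x| ^ (q - 1) * W0.fn (U r) x) * W0.fn (U r) x) ≤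
            ‖u s‖ ^ 2 - ‖u t‖ ^ 2 := by
  obtain ⟨huc, -, U, G, hU, hUu, hG, huG, hweak⟩ := hu
  refine ⟨U, hUu, fun s t hs hst => ?_⟩
  set E : ℝ → ℝ := fun r => ∫ x in Ω, (fluxDensity A (U r) (U r) x +
    a x * (|W0.fn (U r) x| ^ (q - 1) * W0.fn (U r) x) * W0.fn (U r) x) with hE
  have hGU : ∀ T : ℝ, 0 < T → IntegrableOn (fun r => G r (U r)) (Ioc 0 T) := fun T hT =>
    integrable_pairing (hG T hT) (hU T hT)
  rcases hst.eq_or_lt with rfl | hst'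
  · simp
  have ht : 0 < t := hs.trans_lt hst'
  have hsum := hweak U hU
  have hEint : IntegrableOn E (Ioc 0 t) := by
    refine ((hsum t ht).1.sub (hGU t ht)).congr (Eventually.of_forall fun r => ?_)
    simp [hE]
  have hsub : Ioc s t ⊆ Ioc 0 t := Ioc_subset_Ioc_left hs
  have hzero : ∫ r in Ioc s t, (G r (U r) + E r) = 0 := by
    rcases hs.eq_or_lt with rfl | hs'
    · exact (hsum t ht).2
    · have h1 := setIntegral_union (Ioc_disjoint_Ioc_of_le le_rfl) measurableSet_Ioc
        (hsum s hs').1 ((hsum t ht).1.mono_set hsub)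
      rw [Ioc_union_Ioc_eq_Ioc hs hst, (hsum t ht).2, (hsum s hs').2, zero_add] at h1
      exact h1.symm
  rw [integral_add ((hGU t ht).mono_set hsub) (hEint.mono_set hsub)] at hzero
  refine ⟨hEint.mono_set hsub, ?_⟩
  -- `u` is continuous only on `[0, ∞)`; its constant extension to negative times is continuous on
  -- the line.
  have hucont : Continuous fun r => u (max r 0) :=
    huc.comp_continuous (by fun_prop) fun r => mem_Ici.2 (le_max_right _ _)
  have hpos : ∀ r ∈ Ioi (0 : ℝ), u (max r 0) = u r := fun r hr => by
    rw [max_eq_left (le_of_lt hr)]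
  have huG' : IsTimeDeriv (fun r => u (max r 0)) G := by
    intro w φ h1 h2 h3
    rw [← huG w φ h1 h2 h3]
    exact setIntegral_congr_fun measurableSet_Ioi fun r hr => by
      simp only [hpos r hr]
  have henergy := energy_inequality (W0.fn (m := m)) hucont hU hG
    (by
      filter_upwards [hUu, ae_restrict_mem measurableSet_Ioi] with r h1 h2
      rw [h1, hpos r h2])
    (fun w s t hs hst => huG'.inner_sub_inner hucont hG w hs hst) hs hst
  simp only [max_eq_left hs, max_eq_left ht.le] at henergy
  linarith

/-- The differential inequality `d‖u‖²/dt ≤ -2 min{1, C} λ₁(‖u‖²)` in integrated form. -/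
theorem IsWeakSolution.decay {a : EuclideanSpace ℝ (Fin N) → ℝ} {q K : ℝ} (hq0 : 0 < q)
    (hq1 : q < 1) (hΩ : MeasurableSet Ω) (hΩfin : volume Ω ≠ ⊤)
    (hameas : AEMeasurable a (volume.restrict Ω)) (ha : ∀ x ∈ Ω, 0 ≤ a x)
    (haK : ∀ x ∈ Ω, a x ≤ K) {A : Coeff N m} {C : ℝ} (hC : 0 < C) (hcoer : IsCoercive Ω A C)
    {u₀ : L2 Ω} {u : ℝ → L2 Ω} (hu : IsWeakSolution A a q u₀ u) :
    (∀ᵐ t ∂(volume.restrict (Ioi (0 : ℝ))), lambda1 m Ω a q (‖u t‖ ^ 2) ≠ ⊤) ∧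
    (∀ s t : ℝ, 0 ≤ s → s ≤ t → ‖u t‖ ^ 2 ≤ ‖u s‖ ^ 2) ∧
    ∀ s t : ℝ, 0 ≤ s → s ≤ t → 0 < ‖u t‖ ^ 2 →
      2 * min 1 C * (t - s) * (lambda1 m Ω a q (‖u t‖ ^ 2)).toReal ≤ ‖u s‖ ^ 2 - ‖u t‖ ^ 2 := by
  obtain ⟨U, hUu, hdiss⟩ := hu.exists_dissipation
  have hlow := fun t =>
    lambda1_le_dissipation hq0 hq1 hΩ hΩfin hameas ha haK hC hcoer (U t)
  have hκ : 0 < min 1 C := lt_min one_pos hC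
  have hanti : ∀ s t : ℝ, 0 ≤ s → s ≤ t → ‖u t‖ ^ 2 ≤ ‖u s‖ ^ 2 := by
    intro s t hs hst
    have h1 := (hdiss s t hs hst).2
    have h2 := setIntegral_nonneg (μ := volume) (measurableSet_Ioc (a := s) (b := t)) fun r _ =>
      (mul_nonneg hκ.le ENNReal.toReal_nonneg).trans (hlow r).2
    linarith
  refine ⟨hUu.mono fun t ht => ht ▸ (hlow t).1, hanti, fun s t hs hst hyt => ?_⟩
  obtain ⟨h1, h2⟩ := hdiss s t hs hst
  have hUu' : ∀ᵐ r ∂(volume.restrict (Ioc s t)), W0.fn (U r) = u r :=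
    ae_restrict_of_ae_restrict_of_subset (fun r hr => mem_Ioi.2 (hs.trans_lt hr.1)) hUu
  -- For `r ≤ t` one has `‖u r‖ ≥ ‖u t‖`, so monotonicity of `λ₁` bounds the dissipation on `(s, t]`
  -- below by its value at the right endpoint.
  have h3 : ∫ _r in Ioc s t, min 1 C * (lambda1 m Ω a q (‖u t‖ ^ 2)).toReal ≤
      ∫ r in Ioc s t, ∫ x in Ω, (fluxDensity A (U r) (U r) x +
        a x * (|W0.fn (U r) x| ^ (q - 1) * W0.fn (U r) x) * W0.fn (U r) x) := by
    refine integral_mono_ae (integrable_const _) h1 ?_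
    filter_upwards [hUu', ae_restrict_mem measurableSet_Ioc] with r hr hrI
    refine le_trans (mul_le_mul_of_nonneg_left ?_ hκ.le) (hlow r).2
    refine ENNReal.toReal_mono (hlow r).1 (lambda1_mono hq0 hΩ ha hyt ?_)
    rw [hr]
    exact hanti r t (hs.trans hrI.1.le) hrI.2
  rw [setIntegral_const, smul_eq_mul, Real.volume_real_Ioc_of_le hst] at h3
  calc 2 * min 1 C * (t - s) * (lambda1 m Ω a q (‖u t‖ ^ 2)).toReal
      = 2 * ((t - s) * (min 1 C * (lambda1 m Ω a q (‖u t‖ ^ 2)).toReal)) := by ring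
    _ ≤ _ := (mul_le_mul_of_nonneg_left h3 zero_le_two).trans h2

/-- A weak solution that is nonzero at time `t` satisfies
`2 min{1, C} t ≤ ∫_0^{‖u(0)‖²} dh / λ₁(h)`. -/
theorem IsWeakSolution.mul_time_le {a : EuclideanSpace ℝ (Fin N) → ℝ} {q K : ℝ} (hq0 : 0 < q)
    (hq1 : q < 1) (hΩ : MeasurableSet Ω) (hΩfin : volume Ω ≠ ⊤)
    (hameas : AEMeasurable a (volume.restrict Ω)) (ha : ∀ x ∈ Ω, 0 ≤ a x)
    (haK : ∀ x ∈ Ω, a x ≤ K) {A : Coeff N m} {C : ℝ} (hC : 0 < C) (hcoer : IsCoercive Ω A C)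
    (hint : (∫⁻ h in Ioc (0 : ℝ) 1, (lambda1 m Ω a q h)⁻¹) < ⊤)
    {u₀ : L2 Ω} {u : ℝ → L2 Ω} (hu : IsWeakSolution A a q u₀ u) {t : ℝ} (ht : 0 ≤ t)
    (hut : u t ≠ 0) :
    ENNReal.ofReal (2 * min 1 C * t) ≤
      ∫⁻ h in Ioc (0 : ℝ) (‖u₀‖ ^ 2), (lambda1 m Ω a q h)⁻¹ := by
  rcases ht.eq_or_lt with rfl | ht0
  · simp
  obtain ⟨hfin, hanti, hdecay⟩ := hu.decay hq0 hq1 hΩ hΩfin hameas ha haK hC hcoer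
  have hmono : ∀ h h', 0 < h → h ≤ h' → lambda1 m Ω a q h ≤ lambda1 m Ω a q h' :=
    fun h h' => lambda1_mono hq0 hΩ ha
  have hsub : ∀ h h', 0 < h → h ≤ h' →
      lambda1 m Ω a q h' ≤ ENNReal.ofReal (h' / h) * lambda1 m Ω a q h :=
    fun h h' => lambda1_le_div_mul hq1 hΩ ha
  have hyt : 0 < ‖u t‖ ^ 2 := by positivity
  -- Some time `r ∈ (0, t]` gives a positive level `‖u r‖²` where `λ₁` is finite. Finiteness spreads
  -- to lower levels by monotonicity and to higher ones by scaling.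
  have hfin' : ∀ h, 0 < h → lambda1 m Ω a q h ≠ ⊤ := by
    have hmem : ∀ᵐ r ∂(volume.restrict (Ioc 0 t)),
        lambda1 m Ω a q (‖u r‖ ^ 2) ≠ ⊤ ∧ r ∈ Ioc 0 t :=
      (ae_restrict_of_ae_restrict_of_subset (fun r hr => mem_Ioi.2 hr.1) hfin).and
        (ae_restrict_mem measurableSet_Ioc)
    have : NeZero (volume.restrict (Ioc 0 t)) := ⟨by
      rw [Ne, Measure.restrict_eq_zero, Real.volume_Ioc, sub_zero]
      exact (ENNReal.ofReal_pos.2 ht0).ne'⟩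
    obtain ⟨r, hr, hr0, hrt⟩ := hmem.exists
    have hyr := hyt.trans_le (hanti r t hr0.le hrt)
    intro h hh
    rcases le_total h (‖u r‖ ^ 2) with hle | hle
    · exact ne_top_of_le_ne_top hr (hmono _ _ hh hle)
    · exact ne_top_of_le_ne_top (ENNReal.mul_ne_top ENNReal.ofReal_ne_top hr) (hsub _ _ hyr hle)
  have hmain := mul_time_le_lintegral_inv (y := fun t => ‖u t‖ ^ 2) (κ := 2 * min 1 C)
    (mul_pos two_pos (lt_min one_pos hC)) hmono hsub
    (fun h hh => ne_zero_of_lintegral_inv_lt_top hmono hint hh) hfin' hanti hdecay ht hyt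
  simpa only [hu.2.1] using hmain

end Solution

end Extinction

/-! ### The extinction time as the first zero of `u`. -/

theorem proposition2p1 (N m : ℕ) (hN : 1 ≤ N) (hm : 1 ≤ m)
    (Ω : Set (EuclideanSpace ℝ (Fin N))) (hΩo : IsOpen Ω) (hΩb : Bornology.IsBounded Ω)
    (q : ℝ) (hq0 : 0 < q) (hq1 : q < 1)
    (a : EuclideanSpace ℝ (Fin N) → ℝ) (ha_meas : AEMeasurable a (volume.restrict Ω))
    (ha_nonneg : ∀ x ∈ Ω, 0 ≤ a x) (ha_bdd : ∃ K : ℝ, ∀ x ∈ Ω, a x ≤ K)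
    (A : Extinction.Coeff N m) (hA : Extinction.IsCaratheodory Ω A)
    (hgrowth : Extinction.HasSublinearGrowth Ω A)
    (C : ℝ) (hC : 0 < C) (hcoer : Extinction.IsCoercive Ω A C)
    (hint : (∫⁻ h in Ioc (0 : ℝ) 1, (Extinction.lambda1 m Ω a q h)⁻¹) < ⊤)
    (u₀ : Extinction.L2 Ω) (u : ℝ → Extinction.L2 Ω)
    (hu : Extinction.IsWeakSolution A a q u₀ u) :
    ∃ T : ℝ, Extinction.IsExtinctionTime u T ∧
      (∫⁻ h in Ioc (0 : ℝ) (‖u₀‖ ^ 2), (Extinction.lambda1 m Ω a q h)⁻¹) < ⊤ ∧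
      ENNReal.ofReal T ≤ ENNReal.ofReal (1 / (2 * min 1 C)) *
        ∫⁻ h in Ioc (0 : ℝ) (‖u₀‖ ^ 2), (Extinction.lambda1 m Ω a q h)⁻¹ := by
  obtain ⟨K, haK⟩ := ha_bdd
  have hΩ := hΩo.measurableSet
  have hΩfin : volume Ω ≠ ⊤ := hΩb.measure_lt_top.ne
  have hmono : ∀ h h', 0 < h → h ≤ h' →
      Extinction.lambda1 m Ω a q h ≤ Extinction.lambda1 m Ω a q h' :=
    fun h h' => Extinction.lambda1_mono hq0 hΩ ha_nonneg
  have hfinite := Extinction.lintegral_inv_lt_top hmono hint (‖u₀‖ ^ 2)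
  set J := ∫⁻ h in Ioc (0 : ℝ) (‖u₀‖ ^ 2), (Extinction.lambda1 m Ω a q h)⁻¹ with hJ
  have hκ : 0 < 2 * min 1 C := mul_pos two_pos (lt_min one_pos hC)
  have htime : ∀ t, 0 ≤ t → u t ≠ 0 → t ≤ 1 / (2 * min 1 C) * J.toReal := by
    intro t ht hut
    have h1 := hu.mul_time_le hq0 hq1 hΩ hΩfin ha_meas ha_nonneg haK hC hcoer hint ht hut
    rw [ENNReal.ofReal_le_iff_le_toReal hfinite.ne] at h1
    rw [one_div, inv_mul_eq_div, le_div_iff₀ hκ]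
    linarith
  have hanti := (hu.decay hq0 hq1 hΩ hΩfin ha_meas ha_nonneg haK hC hcoer).2.1
  set Z : Set ℝ := Ici 0 ∩ u ⁻¹' {0} with hZ
  have hZclosed : IsClosed Z := hu.1.preimage_isClosed_of_isClosed isClosed_Ici isClosed_singleton
  have hZbdd : BddBelow Z := ⟨0, fun t ht => ht.1⟩
  have hJ0 : 0 ≤ 1 / (2 * min 1 C) * J.toReal := by positivity
  have hZne : Z.Nonempty := by
    refine ⟨1 / (2 * min 1 C) * J.toReal + 1, mem_Ici.2 (by linarith), ?_⟩
    by_contra hne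
    linarith [htime _ (by linarith) hne]
  have hmem : sInf Z ∈ Z := hZclosed.csInf_mem hZne hZbdd
  refine ⟨sInf Z, ⟨⟨hmem.1, fun t ht => ?_⟩, fun s hs => ?_⟩, hfinite, ?_⟩
  · have h1 := hanti (sInf Z) t hmem.1 ht
    have h2 : u (sInf Z) = 0 := hmem.2
    rw [h2, norm_zero] at h1
    have h3 : ‖u t‖ ^ 2 = 0 := le_antisymm (by simpa using h1) (by positivity)
    simpa using h3
  · exact csInf_le hZbdd ⟨hs.1, hs.2 s le_rfl⟩
  · have hle : sInf Z ≤ 1 / (2 * min 1 C) * J.toReal := by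
      -- Every `t ∈ [0, sInf Z)` has `u t ≠ 0`, so the time bound holds up to the infimum.
      refine le_of_forall_lt_imp_le_of_dense fun t ht => ?_
      rcases lt_or_ge t 0 with ht0 | ht0
      · linarith
      · exact htime t ht0 fun h0 => (csInf_le hZbdd ⟨ht0, h0⟩).not_gt ht
    rw [← ENNReal.ofReal_toReal hfinite.ne, ← ENNReal.ofReal_mul (by positivity)]
    exact ENNReal.ofReal_le_ofReal hle
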